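/- Let $\Sigma$ be a smooth three-manifold, let $\mathfrak{e}=(e_u,e_l,e_n)$ be a smooth global coframe on $\Sigma$, let $h_{\mathfrak{e}}=e_u\otimes e_u+e_l\otimes e_l+e_n\otimes e_n$ be the associated Riemannian metric, with Levi-Civita connection $\nabla^{\mathfrak{e}}$, and let $\Theta\in\Gamma(T^*\Sigma\odot T^*\Sigma)$ be a smooth symmetric two-tensor. For $a\in\{u,l,n\}$ let $e_a^\sharp$ be the metric dual of $e_a$ and write $\Theta(e_a)=\Theta(e_a^\sharp,\cdot)$. Let $\lambda\in\mathbb{R}\setminus\{0\}$ and suppose that $(\mathfrak{e},\Theta)$ is a Killing Cauchy pair with constant $\lambda$, that is, \[ \mathrm{d}e_u=\Theta(e_u)\wedge e_u+\lambda\, e_u\wedge e_l,\qquad \mathrm{d}e_l=\Theta(e_l)\wedge e_u,\qquad \mathrm{d}e_n=\Theta(e_n)\wedge e_u+\lambda\, e_n\wedge e_l, \] and $[\Theta(e_u)+\lambda e_l]=0\in H^1(\Sigma,\mathbb{R})$, i.e. $\Theta(e_u)+\lambda e_l$ is the differential of a smooth function on $\Sigma$. Then the Hamiltonian constraint with cosmological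 constant $\Lambda=-3\lambda^2$, \[ \mathrm{R}_{h_{\mathfrak{e}}}=|\Theta|^2_{h_{\mathfrak{e}}}-\mathrm{Tr}_{h_{\mathfrak{e}}}(\Theta)^2-6\lambda^2\quad\text{on }\Sigma, \] where $\mathrm{R}_{h_{\mathfrak{e}}}$ is the scalar curvature, holds if and only if the momentum constraint \[ \mathrm{d}\,\mathrm{Tr}_{h_{\mathfrak{e}}}(\Theta)=\mathrm{div}_{h_{\mathfrak{e}}}(\Theta)\quad\text{on }\Sigma \] holds, where $\mathrm{div}_{h_{\mathfrak{e}}}(\Theta)(X)=\sum_{a}(\nabla^{\mathfrak{e}}_{e_a^\sharp}\Theta)(e_a^\sharp,X)$. -/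

import Mathlib

open Bundle VectorField
open scoped Manifold ContDiff

noncomputable section

namespace KillingCauchy

/-- The model space of three-manifolds. -/
abbrev E3 : Type := EuclideanSpace ℝ (Fin 3)

variable (M : Type*) [TopologicalSpace M] [ChartedSpace E3 M] [IsManifold (𝓡 3) ∞ M]

/-- (Not necessarily smooth) vector fields. -/
abbrev VField : Type _ := (p : M) → TangentSpace (𝓡 3) p

/-- (Not necessarily smooth) one-forms. -/
abbrev OneForm : Type _ := (p : M) → TangentSpace (𝓡 3) p →L[ℝ] ℝ

/-- (Not necessarily smooth) fields of bilinear forms on the tangent spaces. -/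
abbrev BilinField : Type _ :=
  (p : M) → TangentSpace (𝓡 3) p →L[ℝ] TangentSpace (𝓡 3) p →L[ℝ] ℝ

variable {M}

/-- Smooth vector fields: smooth sections of the tangent bundle. -/
def VField.IsSmooth (X : VField M) : Prop :=
  ContMDiff (𝓡 3) ((𝓡 3).prod 𝓘(ℝ, E3)) ∞
    (fun p => TotalSpace.mk' E3 (E := fun q : M => TangentSpace (𝓡 3) q) p (X p))

/-- Smooth one-forms: smooth sections of the cotangent bundle. -/
def OneForm.IsSmooth (α : OneForm M) : Prop :=
  ContMDiff (𝓡 3) ((𝓡 3).prod 𝓘(ℝ, E3 →L[ℝ] ℝ)) ∞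
    (fun p => TotalSpace.mk' (E3 →L[ℝ] ℝ)
      (E := fun q : M => TangentSpace (𝓡 3) q →L[ℝ] Trivial M ℝ q) p (α p))

/-- Smooth fields of bilinear forms: smooth sections of `T*M ⊗ T*M`. -/
def BilinField.IsSmooth (Θ : BilinField M) : Prop :=
  ContMDiff (𝓡 3) ((𝓡 3).prod 𝓘(ℝ, E3 →L[ℝ] E3 →L[ℝ] ℝ)) ∞
    (fun p => TotalSpace.mk' (E3 →L[ℝ] E3 →L[ℝ] ℝ)
      (E := fun q : M => TangentSpace (𝓡 3) q →L[ℝ] TangentSpace (𝓡 3) q →L[ℝ] Trivial M ℝ q)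
      p (Θ p))

variable (M) in
/-- A smooth symmetric two-tensor `Θ ∈ Γ(T*M ⊙ T*M)`. -/
structure SymTensor where
  toFun : BilinField M
  smooth : toFun.IsSmooth
  symm : ∀ (p : M) (v w : TangentSpace (𝓡 3) p), toFun p v w = toFun p w v

variable (M) in
/-- A smooth global coframe `(e_u, e_l, e_n)`; the indices `0, 1, 2` stand for `u, l, n`. -/
structure Coframe where
  form : Fin 3 → OneForm M
  smooth : ∀ a, (form a).IsSmooth
  linearIndependent : ∀ p : M, LinearIndependent ℝ (fun a => form a p)

/-- The one-form `e_u`. -/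
abbrev Coframe.u (e : Coframe M) : OneForm M := e.form 0
/-- The one-form `e_l`. -/
abbrev Coframe.l (e : Coframe M) : OneForm M := e.form 1
/-- The one-form `e_n`. -/
abbrev Coframe.n (e : Coframe M) : OneForm M := e.form 2

/-- The derivative `X(f)` of a function along a vector field. -/
def dirDeriv (X : VField M) (f : M → ℝ) : M → ℝ :=
  fun p => mvfderiv (𝓡 3) f p (X p)

/-- The exterior derivative of a one-form:
`dα(X, Y) = X(α(Y)) - Y(α(X)) - α([X, Y])`. -/
def extDeriv1 (α : OneForm M) (X Y : VField M) : M → ℝ := fun p =>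
  dirDeriv X (fun q => α q (Y q)) p - dirDeriv Y (fun q => α q (X q)) p
    - α p (mlieBracket (𝓡 3) X Y p)

/-- The wedge product of one-forms: `(α ∧ β)(X, Y) = α(X) β(Y) - α(Y) β(X)`. -/
def wedge (α β : OneForm M) (X Y : VField M) : M → ℝ := fun p =>
  α p (X p) * β p (Y p) - α p (Y p) * β p (X p)

/-- `α` vanishes in `H¹(M, ℝ)`: it is the differential of a smooth function. -/
def IsExact (α : OneForm M) : Prop :=
  ∃ f : M → ℝ, ContMDiff (𝓡 3) 𝓘(ℝ, ℝ) ∞ f ∧ ∀ p, α p = mvfderiv (𝓡 3) f p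

namespace Coframe

variable (e : Coframe M)

theorem bijective (p : M) :
    Function.Bijective (LinearMap.pi (fun a => (e.form a p : TangentSpace (𝓡 3) p →ₗ[ℝ] ℝ))) := by
  have hfd : FiniteDimensional ℝ (TangentSpace (𝓡 3) p) :=
    inferInstanceAs (FiniteDimensional ℝ E3)
  have hdim : Module.finrank ℝ (TangentSpace (𝓡 3) p) = 3 :=
    (finrank_euclideanSpace_fin : Module.finrank ℝ E3 = 3)
  have hli : LinearIndependent ℝ
      (fun a => ((e.form a p : TangentSpace (𝓡 3) p →ₗ[ℝ] ℝ) :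
        Module.Dual ℝ (TangentSpace (𝓡 3) p))) :=
    (e.linearIndependent p).map' (ContinuousLinearMap.coeLM ℝ)
      (LinearMap.ker_eq_bot.2 ContinuousLinearMap.coe_injective)
  have hspan := hli.span_eq_top_of_card_eq_finrank' (by
    rw [Subspace.dual_finrank_eq, hdim]; simp)
  have hinj : Function.Injective
      (LinearMap.pi (fun a => (e.form a p : TangentSpace (𝓡 3) p →ₗ[ℝ] ℝ))) := by
    rw [← LinearMap.ker_eq_bot, LinearMap.ker_eq_bot']
    intro v hv
    refine (Module.forall_dual_apply_eq_zero_iff ℝ v).1 fun φ => ?_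
    have hφ : φ ∈ Submodule.span ℝ (Set.range
      (fun a => ((e.form a p : TangentSpace (𝓡 3) p →ₗ[ℝ] ℝ) :
        Module.Dual ℝ (TangentSpace (𝓡 3) p)))) := by rw [hspan]; trivial
    induction hφ using Submodule.span_induction with
    | mem x hx => obtain ⟨a, rfl⟩ := hx; exact congrFun hv a
    | zero => rfl
    | add x y _ _ hx hy => rw [LinearMap.add_apply, hx, hy, add_zero]
    | smul c x _ hx => rw [LinearMap.smul_apply, hx, smul_zero]
  exact ⟨hinj, (LinearMap.injective_iff_surjective_of_finrank_eq_finrank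
    (by rw [hdim]; simp)).1 hinj⟩

/-- The frame dual to `e`, i.e. `e_a(E_b) = δ_ab`. As `e` is orthonormal for `h_e`, the vector
field `E_a` is the metric dual `e_a^♯`. -/
def frame (a : Fin 3) : VField M := fun p =>
  (LinearEquiv.ofBijective _ (e.bijective p)).symm (Pi.single a 1)

theorem form_frame (a b : Fin 3) (p : M) :
    e.form a p (e.frame b p) = if a = b then 1 else 0 := by
  have := congrFun ((LinearEquiv.ofBijective _ (e.bijective p)).apply_symm_apply
    (Pi.single b 1)) a
  exact this.trans (Pi.single_apply b 1 a)

/-- The Riemannian metric `h_e = e_u ⊗ e_u + e_l ⊗ e_l + e_n ⊗ e_n`. -/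
def metric : BilinField M := fun p => ∑ a, (e.form a p).smulRight (e.form a p)

/-- The right-hand side of the Koszul formula for the metric `h_e`:
`2 h(∇_X Y, Z) = X h(Y, Z) + Y h(Z, X) - Z h(X, Y) + h([X, Y], Z) - h([Y, Z], X) + h([Z, X], Y)`. -/
def koszul (X Y Z : VField M) : M → ℝ := fun p =>
  dirDeriv X (fun q => e.metric q (Y q) (Z q)) p
    + dirDeriv Y (fun q => e.metric q (Z q) (X q)) p
    - dirDeriv Z (fun q => e.metric q (X q) (Y q)) p
    + e.metric p (mlieBracket (𝓡 3) X Y p) (Z p)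
    - e.metric p (mlieBracket (𝓡 3) Y Z p) (X p)
    + e.metric p (mlieBracket (𝓡 3) Z X p) (Y p)

/-- The Levi-Civita connection `∇_X Y` of `h_e`, given by the Koszul formula: the component of
`∇_X Y` along the `h_e`-orthonormal frame field `E_c` is `h(∇_X Y, E_c)`. -/
def nabla (X Y : VField M) : VField M := fun p =>
  ∑ c, (e.koszul X Y (e.frame c) p / 2) • e.frame c p

/-- The curvature `R(X, Y) Z = ∇_X ∇_Y Z - ∇_Y ∇_X Z - ∇_[X, Y] Z` of `h_e`. -/
def riemann (X Y Z : VField M) : VField M := fun p =>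
  e.nabla X (e.nabla Y Z) p - e.nabla Y (e.nabla X Z) p
    - e.nabla (fun q => mlieBracket (𝓡 3) X Y q) Z p

/-- The Ricci curvature of `h_e`: `Ric(Y, Z)` is the trace of `X ↦ R(X, Y) Z`. -/
def ricci (Y Z : VField M) : M → ℝ := fun p =>
  ∑ a, e.metric p (e.riemann (e.frame a) Y Z p) (e.frame a p)

/-- The scalar curvature of `h_e`: the `h_e`-trace of the Ricci curvature. -/
def scal : M → ℝ := fun p => ∑ a, e.ricci (e.frame a) (e.frame a) p

/-- The `h_e`-trace of `Θ`. -/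
def tr (Θ : SymTensor M) : M → ℝ := fun p =>
  ∑ a, Θ.toFun p (e.frame a p) (e.frame a p)

/-- The squared norm `|Θ|²` with respect to `h_e`. -/
def normSq (Θ : SymTensor M) : M → ℝ := fun p =>
  ∑ a, ∑ b, (Θ.toFun p (e.frame a p) (e.frame b p)) ^ 2

/-- The covariant derivative `(∇_X Θ)(Y, Z) = X(Θ(Y, Z)) - Θ(∇_X Y, Z) - Θ(Y, ∇_X Z)`. -/
def nablaTensor (Θ : SymTensor M) (X Y Z : VField M) : M → ℝ := fun p =>
  dirDeriv X (fun q => Θ.toFun q (Y q) (Z q)) p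
    - Θ.toFun p (e.nabla X Y p) (Z p) - Θ.toFun p (Y p) (e.nabla X Z p)

/-- The divergence `div(Θ)(X) = ∑_a (∇_{E_a} Θ)(E_a, X)` with respect to `h_e`. -/
def div (Θ : SymTensor M) (X : VField M) : M → ℝ := fun p =>
  ∑ a, e.nablaTensor Θ (e.frame a) (e.frame a) X p

/-- The one-form `Θ(e_a) = Θ(e_a^♯, ·)`. -/
def contract (Θ : SymTensor M) (a : Fin 3) : OneForm M := fun p =>
  Θ.toFun p (e.frame a p)

end Coframe

/-- `(e, Θ)` is a Killing Cauchy pair with Killing constant `lam`. -/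
structure IsKillingCauchyPair (lam : ℝ) (e : Coframe M) (Θ : SymTensor M) : Prop where
  ne_zero : lam ≠ 0
  d_u : ∀ X Y : VField M, X.IsSmooth → Y.IsSmooth → ∀ p,
    extDeriv1 e.u X Y p = wedge (e.contract Θ 0) e.u X Y p + lam * wedge e.u e.l X Y p
  d_l : ∀ X Y : VField M, X.IsSmooth → Y.IsSmooth → ∀ p,
    extDeriv1 e.l X Y p = wedge (e.contract Θ 1) e.u X Y p
  d_n : ∀ X Y : VField M, X.IsSmooth → Y.IsSmooth → ∀ p,
    extDeriv1 e.n X Y p = wedge (e.contract Θ 2) e.u X Y p + lam * wedge e.n e.l X Y p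
  exact : IsExact (fun p => e.contract Θ 0 p + lam • e.l p)

/-- The Hamiltonian constraint `R_h = |Θ|²_h - Tr_h(Θ)² + 2 Λ` for `h = h_e`, with
cosmological constant `Λ`. -/
def HamiltonianConstraint (Lam : ℝ) (e : Coframe M) (Θ : SymTensor M) : Prop :=
  ∀ p, e.scal p = e.normSq Θ p - (e.tr Θ p) ^ 2 + 2 * Lam

/-- The momentum constraint `d Tr_h(Θ) = div_h(Θ)` for `h = h_e`. -/
def MomentumConstraint (e : Coframe M) (Θ : SymTensor M) : Prop :=
  ∀ X : VField M, X.IsSmooth → ∀ p, dirDeriv X (e.tr Θ) p = e.div Θ X p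

end KillingCauchy

end

/-! Everything is computed in the frame `E_a` dual to the coframe, with structure functions `c_abk`.
All three structure equations have the shape `de_k = Θ(e_k) ∧ e_u + λ e_k ∧ e_l` (for `k = l` the
last term vanishes), so every `c_abk` is an affine function of the components of `Θ` (`struct_eq`).
The Koszul formula then makes the scalar curvature a first-order expression in `Θ`, of the same
order as `d Tr Θ - div Θ`.

The one-form `d Tr Θ - div Θ` has three components. The Hamiltonian defect is twice the
`u`-component (`hamiltonian_defect`), by algebra alone. The `l`- and `n`-components always vanish
(`momentumDefect_l`, `momentumDefect_n`): their derivative terms are those of the Jacobi identity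
for the frame together with those of `d(Θ(e_u) + λ e_l) = 0`. Hence each constraint amounts to the
vanishing of the `u`-component. -/

noncomputable section

namespace KillingCauchy

variable {M : Type*} [TopologicalSpace M] [ChartedSpace E3 M]

/-- Smooth real-valued functions. -/
def IsSmoothFun (f : M → ℝ) : Prop := ContMDiff (𝓡 3) 𝓘(ℝ, ℝ) ∞ f

/-! ### Calculus of smooth functions -/

section Functions

variable {f g : M → ℝ}

theorem IsSmoothFun.mdifferentiableAt (hf : IsSmoothFun f) (p : M) :
    MDifferentiableAt (𝓡 3) 𝓘(ℝ, ℝ) f p :=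
  (ContMDiff.mdifferentiable hf (by simp)) p

theorem isSmoothFun_const (c : ℝ) : IsSmoothFun (fun _ : M => c) := contMDiff_const

theorem IsSmoothFun.add (hf : IsSmoothFun f) (hg : IsSmoothFun g) :
    IsSmoothFun (fun p => f p + g p) := ContMDiff.add hf hg

theorem IsSmoothFun.sub (hf : IsSmoothFun f) (hg : IsSmoothFun g) :
    IsSmoothFun (fun p => f p - g p) := ContMDiff.sub hf hg

theorem IsSmoothFun.mul (hf : IsSmoothFun f) (hg : IsSmoothFun g) :
    IsSmoothFun (fun p => f p * g p) := ContMDiff.mul hf hg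

theorem IsSmoothFun.sum {ι : Type*} {s : Finset ι} {f : ι → M → ℝ}
    (hf : ∀ i ∈ s, IsSmoothFun (f i)) : IsSmoothFun (fun p => ∑ i ∈ s, f i p) :=
  contMDiff_finsetSum hf

variable (X : VField M) (p : M)

theorem dirDeriv_const (c : ℝ) : dirDeriv X (fun _ => c) p = 0 := by
  simp [dirDeriv, mvfderiv_const]

theorem dirDeriv_add (hf : IsSmoothFun f) (hg : IsSmoothFun g) :
    dirDeriv X (fun q => f q + g q) p = dirDeriv X f p + dirDeriv X g p := by
  simp [dirDeriv, mvfderiv_fun_add (hf.mdifferentiableAt p) (hg.mdifferentiableAt p)]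

theorem dirDeriv_sub (hf : IsSmoothFun f) (hg : IsSmoothFun g) :
    dirDeriv X (fun q => f q - g q) p = dirDeriv X f p - dirDeriv X g p := by
  simp [dirDeriv, mvfderiv_fun_sub (hf.mdifferentiableAt p) (hg.mdifferentiableAt p)]

theorem dirDeriv_mul (hf : IsSmoothFun f) (hg : IsSmoothFun g) :
    dirDeriv X (fun q => f q * g q) p = f p * dirDeriv X g p + g p * dirDeriv X f p := by
  simp [dirDeriv, mvfderiv_fun_mul (hf.mdifferentiableAt p) (hg.mdifferentiableAt p)]

theorem dirDeriv_sum {ι : Type*} {s : Finset ι} {f : ι → M → ℝ}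
    (hf : ∀ i ∈ s, IsSmoothFun (f i)) :
    dirDeriv X (fun q => ∑ i ∈ s, f i q) p = ∑ i ∈ s, dirDeriv X (f i) p := by
  classical
  induction s using Finset.induction_on with
  | empty => simpa using dirDeriv_const X p 0
  | insert i s hi ih =>
    have hs : ∀ j ∈ s, IsSmoothFun (f j) := fun j hj => hf j (Finset.mem_insert_of_mem hj)
    simp only [Finset.sum_insert hi]
    rw [dirDeriv_add X p (hf i (Finset.mem_insert_self i s)) (IsSmoothFun.sum hs), ih hs]

end Functions

variable [IsManifold (𝓡 3) ∞ M]

/-! ### Smooth pairings and smoothness of the dual frame -/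

theorem OneForm.IsSmooth.apply {α : OneForm M} {X : VField M} (hα : α.IsSmooth)
    (hX : X.IsSmooth) : IsSmoothFun (fun p => α p (X p)) := by
  intro p
  exact ((Bundle.contMDiffAt_section p).1
    (ContMDiff.clm_bundle_apply (b := fun q : M => q) (E₁ := fun q : M => TangentSpace (𝓡 3) q)
      (E₂ := Trivial M ℝ) hα hX p))

theorem BilinField.IsSmooth.apply {Θ : BilinField M} {X Y : VField M} (hΘ : Θ.IsSmooth)
    (hX : X.IsSmooth) (hY : Y.IsSmooth) : IsSmoothFun (fun p => Θ p (X p) (Y p)) := by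
  intro p
  exact ((Bundle.contMDiffAt_section p).1
    (ContMDiff.clm_bundle_apply₂ (b := fun q : M => q) (E₁ := fun q : M => TangentSpace (𝓡 3) q)
      (E₂ := fun q : M => TangentSpace (𝓡 3) q) (E₃ := Trivial M ℝ) hΘ hX hY p))

theorem VField.IsSmooth.mdifferentiableAt {X : VField M} (hX : X.IsSmooth) (p : M) :
    MDifferentiableAt (𝓡 3) ((𝓡 3).prod 𝓘(ℝ, E3))
      (fun q => TotalSpace.mk' E3 (E := fun q : M => TangentSpace (𝓡 3) q) q (X q)) p :=
  (ContMDiff.mdifferentiable hX (by simp)) p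

namespace Coframe

variable (e : Coframe M)

theorem ext_form {p : M} {v w : TangentSpace (𝓡 3) p} (h : ∀ a, e.form a p v = e.form a p w) :
    v = w :=
  (e.bijective p).1 (funext h)

/-- In a trivialization the coframe is a smooth family `φ` of linear maps to `ℝ³`, invertible on the
base set. The frame is `φ⁻¹` applied to a basis vector, and inversion of operators is smooth at
invertible ones. -/
theorem frame_smooth (b : Fin 3) : (e.frame b).IsSmooth := by
  intro p₀
  rw [contMDiffAt_totalSpace]
  refine ⟨contMDiffAt_id, ?_⟩
  let T := trivializationAt E3 (fun q : M => TangentSpace (𝓡 3) q) p₀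
  let c : Fin 3 → M → (E3 →L[ℝ] ℝ) := fun a q =>
    ContinuousLinearMap.inCoordinates E3 (fun q : M => TangentSpace (𝓡 3) q) ℝ (Trivial M ℝ)
      p₀ q p₀ q (e.form a q)
  have hc : ∀ a, ContMDiffAt (𝓡 3) 𝓘(ℝ, E3 →L[ℝ] ℝ) ∞ (c a) p₀ := fun a =>
    ((contMDiffAt_hom_bundle _).1 (e.smooth a p₀)).2
  let φ : M → (E3 →L[ℝ] (Fin 3 → ℝ)) := fun q =>
    ∑ a, ContinuousLinearMap.smulRightL ℝ E3 (Fin 3 → ℝ) (c a q) (Pi.single a 1)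
  have hφ : ContMDiffAt (𝓡 3) 𝓘(ℝ, E3 →L[ℝ] (Fin 3 → ℝ)) ∞ φ p₀ := by
    refine contMDiffAt_finsetSum fun a _ => ?_
    exact (((ContinuousLinearMap.smulRightL ℝ E3 (Fin 3 → ℝ)).flip
      (Pi.single a 1)).contDiff.contMDiff.contMDiffAt).comp p₀ (hc a)
  have key : ∀ q (hq : q ∈ T.baseSet), φ q =
      (((T.continuousLinearEquivAt ℝ q hq).symm.toLinearEquiv.trans
        (LinearEquiv.ofBijective _ (e.bijective q))).toContinuousLinearEquiv :
        E3 →L[ℝ] (Fin 3 → ℝ)) := by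
    intro q hq
    ext v a
    have : c a q v = e.form a q ((T.continuousLinearEquivAt ℝ q hq).symm v) := by
      simp only [c]
      rw [ContinuousLinearMap.inCoordinates_eq hq (by simp)]
      simp [T]
    simp [φ, Pi.single_apply, this]
  -- `ContinuousLinearMap.inverse` is a total function with value zero off the invertible maps, so
  -- smoothness is claimed only at `p₀`, where `key` gives an equivalence.
  have hinv : ContMDiffAt (𝓡 3) 𝓘(ℝ, (Fin 3 → ℝ) →L[ℝ] E3) ∞
      (fun q => (φ q).inverse) p₀ := by
    have h := key p₀ (FiberBundle.mem_baseSet_trivializationAt' p₀)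
    refine ContMDiffAt.comp p₀ (g := ContinuousLinearMap.inverse) ?_ hφ
    rw [h]
    exact (contDiffAt_map_inverse _).contMDiffAt
  have happ := hinv.clm_apply (contMDiffAt_const (c := (Pi.single b 1 : Fin 3 → ℝ)))
  refine happ.congr_of_eventuallyEq ?_
  filter_upwards [T.open_baseSet.mem_nhds (FiberBundle.mem_baseSet_trivializationAt' p₀)]
    with q hq
  rw [key q hq, ContinuousLinearMap.inverse_equiv]
  rfl

/-- The vector field with components `f` in the frame dual to `e`. -/
def comb (f : Fin 3 → M → ℝ) : VField M := fun p => ∑ a, f a p • e.frame a p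

theorem form_comb (f : Fin 3 → M → ℝ) (a : Fin 3) (p : M) : e.form a p (e.comb f p) = f a p := by
  simp [comb, map_sum, form_frame]

theorem eq_comb (X : VField M) : X = e.comb (fun a p => e.form a p (X p)) := by
  funext p
  exact e.ext_form fun a =>
    (e.form_comb (fun a p => e.form a p (X p)) a p).symm

end Coframe

/-! ### Lie brackets, connection and curvature in the dual frame -/

theorem mlieBracket_jacobi {X Y Z : VField M} (hX : X.IsSmooth)
    (hY : Y.IsSmooth) (hZ : Z.IsSmooth) (p : M) :
    mlieBracket (𝓡 3) X (mlieBracket (𝓡 3) Y Z) p =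
      mlieBracket (𝓡 3) (mlieBracket (𝓡 3) X Y) Z p +
        mlieBracket (𝓡 3) Y (mlieBracket (𝓡 3) X Z) p := by
  have : IsManifold (𝓡 3) (minSmoothness ℝ 3) M :=
    IsManifold.of_le (n := ∞) (by simpa using ENat.LEInfty.out)
  have h2 : minSmoothness ℝ 2 ≤ (∞ : WithTop ℕ∞) := by simpa using ENat.LEInfty.out
  exact leibniz_identity_mlieBracket_apply ((hX p).of_le h2) ((hY p).of_le h2) ((hZ p).of_le h2)

namespace Coframe

variable (e : Coframe M)

/-- The structure functions of the frame dual to `e`: `[E_a, E_b] = ∑ k, c_abk E_k`. -/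
def struct (a b k : Fin 3) (p : M) : ℝ :=
  e.form k p (mlieBracket (𝓡 3) (e.frame a) (e.frame b) p)

theorem struct_swap (a b k : Fin 3) (p : M) : e.struct a b k p = -e.struct b a k p := by
  rw [struct, mlieBracket_swap_apply, map_neg, struct]

theorem mlieBracket_frame (a b : Fin 3) :
    mlieBracket (𝓡 3) (e.frame a) (e.frame b) = e.comb (e.struct a b) :=
  e.eq_comb _

theorem form_mlieBracket_smul (X : VField M) {f : M → ℝ} (hf : IsSmoothFun f) (b k : Fin 3)
    (p : M) : e.form k p (mlieBracket (𝓡 3) X (fun q => f q • e.frame b q) p) =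
      (if k = b then dirDeriv X f p else 0) +
        f p * e.form k p (mlieBracket (𝓡 3) X (e.frame b) p) := by
  have h := mlieBracket_smul_right (V := X) (hf.mdifferentiableAt p)
    ((e.frame_smooth b).mdifferentiableAt p)
  have h' : mlieBracket (𝓡 3) X (fun q => f q • e.frame b q) p =
    mvfderiv (𝓡 3) f p (X p) • e.frame b p + f p • mlieBracket (𝓡 3) X (e.frame b) p := h
  rw [h', map_add, map_smul, map_smul, form_frame]
  simp [dirDeriv]

/-- The derivation property of the Lie bracket `[X, ∑ b, f_b E_b]`, in components. -/
theorem form_mlieBracket_comb (X : VField M) {f : Fin 3 → M → ℝ} (hf : ∀ a, IsSmoothFun (f a))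
    (k : Fin 3) (p : M) : e.form k p (mlieBracket (𝓡 3) X (e.comb f) p) =
      dirDeriv X (f k) p + ∑ b, f b p * e.form k p (mlieBracket (𝓡 3) X (e.frame b) p) := by
  have hs : ∀ b, VField.IsSmooth (fun q => f b q • e.frame b q) := fun b =>
    ContMDiff.smul_section (hf b) (e.frame_smooth b)
  have hsplit : e.comb f = ((fun q => f 0 q • e.frame 0 q) + fun q => f 1 q • e.frame 1 q) +
      fun q => f 2 q • e.frame 2 q := by
    funext q
    simp [comb, Fin.sum_univ_three]
  have h01 : VField.IsSmooth
      ((fun q => f 0 q • e.frame 0 q) + fun q => f 1 q • e.frame 1 q) :=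
    ContMDiff.add_section (hs 0) (hs 1)
  rw [hsplit, mlieBracket_add_right (h01.mdifferentiableAt p) ((hs 2).mdifferentiableAt p),
    mlieBracket_add_right ((hs 0).mdifferentiableAt p) ((hs 1).mdifferentiableAt p),
    map_add, map_add, e.form_mlieBracket_smul X (hf 0), e.form_mlieBracket_smul X (hf 1),
    e.form_mlieBracket_smul X (hf 2), Fin.sum_univ_three]
  fin_cases k <;> simp <;> ring

theorem form_mlieBracket_frame_comb (a : Fin 3) {f : Fin 3 → M → ℝ}
    (hf : ∀ a, IsSmoothFun (f a)) (k : Fin 3) (p : M) :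
    e.form k p (mlieBracket (𝓡 3) (e.frame a) (e.comb f) p) =
      dirDeriv (e.frame a) (f k) p + ∑ b, f b p * e.struct a b k p :=
  e.form_mlieBracket_comb _ hf k p

theorem metric_apply (p : M) (v w : TangentSpace (𝓡 3) p) :
    e.metric p v w = ∑ a, e.form a p v * e.form a p w := by
  simp [metric]

theorem metric_frame_right (p : M) (v : TangentSpace (𝓡 3) p) (a : Fin 3) :
    e.metric p v (e.frame a p) = e.form a p v := by
  simp [metric_apply, form_frame]

theorem metric_frame_left (p : M) (v : TangentSpace (𝓡 3) p) (a : Fin 3) :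
    e.metric p (e.frame a p) v = e.form a p v := by
  simp [metric_apply, form_frame]

/-- The connection coefficients `h(∇_{E_a} E_b, E_k)` of the dual frame. -/
def conn (a b k : Fin 3) (p : M) : ℝ :=
  (e.struct a b k p - e.struct b k a p + e.struct k a b p) / 2

/-- General coefficients `f` are needed because the curvature applies `nabla` to `∇_{E_b} E_c`,
which is no longer a frame field. The term `-E_k(f_a)` cancels against the bracket `[E_k, ∑ f_b
E_b]`, while `E_a(f_k)` appears twice. -/
theorem koszul_frame_comb (a k : Fin 3) {f : Fin 3 → M → ℝ} (hf : ∀ a, IsSmoothFun (f a))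
    (p : M) : e.koszul (e.frame a) (e.comb f) (e.frame k) p / 2 =
      dirDeriv (e.frame a) (f k) p + ∑ b, f b p * e.conn a b k p := by
  have h : mlieBracket (𝓡 3) (e.comb f) (e.frame k) p =
      -mlieBracket (𝓡 3) (e.frame k) (e.comb f) p := mlieBracket_swap_apply
  have h' : ∀ b, e.form b p (mlieBracket (𝓡 3) (e.frame k) (e.frame a) p) = e.struct k a b p :=
    fun _ => rfl
  have h'' : ∀ i, e.struct i k a p = -e.struct k i a p := fun i => e.struct_swap i k a p
  simp only [koszul, h, metric_frame_right, metric_frame_left, form_comb, form_frame,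
    dirDeriv_const, map_neg, neg_apply, e.form_mlieBracket_frame_comb _ hf,
    metric_apply _ _ _ (e.comb f p), h', conn, h'', Fin.sum_univ_three]
  ring

/-- All derivatives of `f` cancel: the connection is tensorial in its direction. This handles the
term `∇_[X, Y] Z` of the curvature. -/
theorem koszul_comb_frame (b k : Fin 3) {f : Fin 3 → M → ℝ} (hf : ∀ a, IsSmoothFun (f a))
    (p : M) : e.koszul (e.comb f) (e.frame b) (e.frame k) p / 2 =
      ∑ a, f a p * e.conn a b k p := by
  have h : mlieBracket (𝓡 3) (e.comb f) (e.frame b) p =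
      -mlieBracket (𝓡 3) (e.frame b) (e.comb f) p := mlieBracket_swap_apply
  have h' : ∀ m, e.form m p (mlieBracket (𝓡 3) (e.frame b) (e.frame k) p) = e.struct b k m p :=
    fun _ => rfl
  have h'' : ∀ i, e.struct i b k p = -e.struct b i k p := fun i => e.struct_swap i b k p
  simp only [koszul, h, metric_frame_right, metric_frame_left, form_comb, form_frame,
    dirDeriv_const, map_neg, neg_apply, e.form_mlieBracket_frame_comb _ hf,
    metric_apply _ _ _ (e.comb f p), h', conn, h'', Fin.sum_univ_three]
  ring

theorem nabla_frame_comb (a : Fin 3) {f : Fin 3 → M → ℝ} (hf : ∀ a, IsSmoothFun (f a)) :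
    e.nabla (e.frame a) (e.comb f) =
      e.comb (fun k p => dirDeriv (e.frame a) (f k) p + ∑ b, f b p * e.conn a b k p) := by
  funext p
  simp only [nabla, e.koszul_frame_comb a _ hf, comb]

theorem nabla_comb_frame (b : Fin 3) {f : Fin 3 → M → ℝ} (hf : ∀ a, IsSmoothFun (f a)) :
    e.nabla (e.comb f) (e.frame b) = e.comb (fun k p => ∑ a, f a p * e.conn a b k p) := by
  funext p
  simp only [nabla, e.koszul_comb_frame b _ hf, comb]

theorem frame_eq_comb (a : Fin 3) : e.frame a = e.comb (fun k _ => if k = a then 1 else 0) := by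
  funext p
  simp [comb]

theorem nabla_frame_frame (a b : Fin 3) :
    e.nabla (e.frame a) (e.frame b) = e.comb (e.conn a b) := by
  conv_lhs => rw [e.frame_eq_comb b]
  rw [e.nabla_frame_comb a fun k => isSmoothFun_const _]
  congr 1
  funext k p
  simp [dirDeriv_const]

theorem conn_smooth (hc : ∀ a b k, IsSmoothFun (e.struct a b k)) (a b k : Fin 3) :
    IsSmoothFun (e.conn a b k) := by
  have := (((hc a b k).sub (hc b k a)).add (hc k a b)).mul (isSmoothFun_const 2⁻¹)
  have h : e.conn a b k = fun p =>
      (e.struct a b k p - e.struct b k a p + e.struct k a b p) * 2⁻¹ := by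
    funext q
    simp only [conn, div_eq_mul_inv]
  rw [h]
  exact this

theorem dirDeriv_conn (hc : ∀ a b k, IsSmoothFun (e.struct a b k)) (X : VField M)
    (a b k : Fin 3) (p : M) : dirDeriv X (e.conn a b k) p =
      (dirDeriv X (e.struct a b k) p - dirDeriv X (e.struct b k a) p
        + dirDeriv X (e.struct k a b) p) / 2 := by
  have h : e.conn a b k = fun p =>
      (e.struct a b k p - e.struct b k a p + e.struct k a b p) * 2⁻¹ := by
    funext q
    simp only [conn, div_eq_mul_inv]
  rw [h, dirDeriv_mul X p (((hc a b k).sub (hc b k a)).add (hc k a b)) (isSmoothFun_const 2⁻¹),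
    dirDeriv_add X p ((hc a b k).sub (hc b k a)) (hc k a b),
    dirDeriv_sub X p (hc a b k) (hc b k a), dirDeriv_const]
  ring

theorem riemann_frame (hc : ∀ a b k, IsSmoothFun (e.struct a b k)) (a b c k : Fin 3) (p : M) :
    e.form k p (e.riemann (e.frame a) (e.frame b) (e.frame c) p) =
      (dirDeriv (e.frame a) (e.conn b c k) p + ∑ j, e.conn b c j p * e.conn a j k p)
      - (dirDeriv (e.frame b) (e.conn a c k) p + ∑ j, e.conn a c j p * e.conn b j k p)
      - ∑ m, e.struct a b m p * e.conn m c k p := by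
  have h : (fun q => mlieBracket (𝓡 3) (e.frame a) (e.frame b) q) = e.comb (e.struct a b) :=
    e.mlieBracket_frame a b
  simp only [riemann]
  rw [h, nabla_frame_frame, nabla_frame_frame, e.nabla_frame_comb a (e.conn_smooth hc b c),
    e.nabla_frame_comb b (e.conn_smooth hc a c), e.nabla_comb_frame c (hc a b), map_sub, map_sub,
    form_comb, form_comb, form_comb]

theorem scal_eq (hc : ∀ a b k, IsSmoothFun (e.struct a b k)) (p : M) :
    e.scal p = ∑ b, ∑ a,
      ((dirDeriv (e.frame a) (e.conn b b a) p + ∑ j, e.conn b b j p * e.conn a j a p)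
      - (dirDeriv (e.frame b) (e.conn a b a) p + ∑ j, e.conn a b j p * e.conn b j a p)
      - ∑ m, e.struct a b m p * e.conn m b a p) := by
  simp only [scal, ricci, metric_frame_right, e.riemann_frame hc]

end Coframe

/-! ### Closedness and the Jacobi identity in components -/

theorem mlieBracket_smooth {X Y : VField M} (hX : X.IsSmooth) (hY : Y.IsSmooth) :
    VField.IsSmooth (mlieBracket (𝓡 3) X Y) :=
  have : IsManifold (𝓡 3) (((⊤ : ℕ∞) : WithTop ℕ∞) + 1) M := ‹IsManifold (𝓡 3) ∞ M›
  have : IsManifold (𝓡 3) (minSmoothness ℝ 2) M :=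
    IsManifold.of_le (n := ∞) (by simpa using ENat.LEInfty.out)
  ContDiff.mlieBracket_vectorField (m := ⊤) (n := ⊤) hX hY (by simp)

theorem mlieBracket_smul_eq (X : VField M) {Z : VField M} {f : M → ℝ} (hZ : Z.IsSmooth)
    (hf : IsSmoothFun f) (p : M) : mlieBracket (𝓡 3) X (f • Z) p =
      dirDeriv X f p • Z p + f p • mlieBracket (𝓡 3) X Z p :=
  mlieBracket_smul_right (hf.mdifferentiableAt p) (hZ.mdifferentiableAt p)

/-- `X (Y f) - Y (X f) = [X, Y] f`, obtained from the Jacobi identity for `X`, `Y` and `f Z`. -/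
theorem dirDeriv_mlieBracket {X Y Z : VField M} {f : M → ℝ} (hX : X.IsSmooth) (hY : Y.IsSmooth)
    (hZ : Z.IsSmooth) (hf : IsSmoothFun f) (hXf : IsSmoothFun (dirDeriv X f))
    (hYf : IsSmoothFun (dirDeriv Y f)) {p : M} (hp : Z p ≠ 0) :
    dirDeriv (mlieBracket (𝓡 3) X Y) f p =
      dirDeriv X (dirDeriv Y f) p - dirDeriv Y (dirDeriv X f) p := by
  have expand : ∀ {U V : VField M}, U.IsSmooth → V.IsSmooth → IsSmoothFun (dirDeriv V f) →
      mlieBracket (𝓡 3) U (mlieBracket (𝓡 3) V (f • Z)) p =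
        (dirDeriv U (dirDeriv V f) p • Z p + dirDeriv V f p • mlieBracket (𝓡 3) U Z p) +
        (dirDeriv U f p • mlieBracket (𝓡 3) V Z p +
          f p • mlieBracket (𝓡 3) U (mlieBracket (𝓡 3) V Z) p) := by
    intro U V hU hV hVf
    have hsplit : mlieBracket (𝓡 3) V (f • Z) =
        dirDeriv V f • Z + f • mlieBracket (𝓡 3) V Z :=
      funext fun q => mlieBracket_smul_eq V hZ hf q
    have hVZ := mlieBracket_smooth hV hZ
    have h₁ : VField.IsSmooth (dirDeriv V f • Z) := ContMDiff.smul_section hVf hZ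
    have h₂ : VField.IsSmooth (f • mlieBracket (𝓡 3) V Z) := ContMDiff.smul_section hf hVZ
    rw [hsplit, mlieBracket_add_right (h₁.mdifferentiableAt p) (h₂.mdifferentiableAt p),
      mlieBracket_smul_eq U hZ hVf, mlieBracket_smul_eq U hVZ hf]
  have hfZ : VField.IsSmooth (f • Z) := ContMDiff.smul_section hf hZ
  have j₁ := mlieBracket_jacobi hX hY hfZ p
  have j₂ := mlieBracket_jacobi hX hY hZ p
  -- The cross terms `X(f) [Y, Z] + Y(f) [X, Z]` occur on both sides, and `j₂` matches the terms
  -- carrying `f`. What remains is a multiple of `Z p`, which is nonzero.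
  rw [expand hX hY hYf, expand hY hX hXf, mlieBracket_smul_eq _ hZ hf, j₂] at j₁
  rw [← sub_eq_zero]
  refine (smul_eq_zero.1 ?_).resolve_right hp
  rw [← sub_eq_zero] at j₁
  rw [← neg_eq_zero, ← j₁]
  module

namespace Coframe

variable (e : Coframe M)

theorem frame_ne_zero (a : Fin 3) (p : M) : e.frame a p ≠ 0 := fun h => by
  have := e.form_frame a a p
  simp [h] at this

theorem dirDeriv_comb (f : Fin 3 → M → ℝ) (g : M → ℝ) (p : M) :
    dirDeriv (e.comb f) g p = ∑ a, f a p * dirDeriv (e.frame a) g p := by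
  simp [dirDeriv, comb, map_sum]

/-- Closedness of an exact one-form, in components. -/
theorem exact_closed {α : OneForm M} (hα : IsExact α)
    (hs : ∀ a, IsSmoothFun (fun p => α p (e.frame a p))) (a b : Fin 3) (p : M) :
    dirDeriv (e.frame a) (fun q => α q (e.frame b q)) p
      - dirDeriv (e.frame b) (fun q => α q (e.frame a q)) p =
      ∑ k, e.struct a b k p * α p (e.frame k p) := by
  obtain ⟨f, hf, h⟩ := hα
  have hd : ∀ c, dirDeriv (e.frame c) f = fun q => α q (e.frame c q) := fun c => by
    funext q
    rw [h q, dirDeriv]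
  have key := dirDeriv_mlieBracket (e.frame_smooth a) (e.frame_smooth b) (e.frame_smooth 0) hf
    (by rw [hd]; exact hs a) (by rw [hd]; exact hs b) (e.frame_ne_zero 0 p)
  rw [mlieBracket_frame, dirDeriv_comb, hd, hd] at key
  rw [← key]
  simp only [hd]

theorem jacobi_frame (hc : ∀ a b k, IsSmoothFun (e.struct a b k)) (k : Fin 3) (p : M) :
    (dirDeriv (e.frame 0) (e.struct 1 2 k) p + ∑ j, e.struct 1 2 j p * e.struct 0 j k p) +
    (dirDeriv (e.frame 2) (e.struct 0 1 k) p + ∑ j, e.struct 0 1 j p * e.struct 2 j k p) =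
    dirDeriv (e.frame 1) (e.struct 0 2 k) p + ∑ j, e.struct 0 2 j p * e.struct 1 j k p := by
  have h := congrArg (e.form k p)
    (mlieBracket_jacobi (e.frame_smooth 0) (e.frame_smooth 1) (e.frame_smooth 2) p)
  rw [map_add, mlieBracket_swap_apply (V := mlieBracket (𝓡 3) (e.frame 0) (e.frame 1)), map_neg,
    mlieBracket_frame, mlieBracket_frame, mlieBracket_frame,
    e.form_mlieBracket_frame_comb _ (hc 1 2), e.form_mlieBracket_frame_comb _ (hc 0 1),
    e.form_mlieBracket_frame_comb _ (hc 0 2)] at h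
  rw [h]
  ring

/-- The components of `Θ` in the frame dual to `e`. -/
def comp (Θ : SymTensor M) (a b : Fin 3) (p : M) : ℝ :=
  Θ.toFun p (e.frame a p) (e.frame b p)

variable (Θ : SymTensor M)

theorem comp_symm (a b : Fin 3) : e.comp Θ a b = e.comp Θ b a :=
  funext fun p => Θ.symm p _ _

theorem comp_smooth (a b : Fin 3) : IsSmoothFun (e.comp Θ a b) :=
  Θ.smooth.apply (e.frame_smooth a) (e.frame_smooth b)

theorem comp_comb_right (a : Fin 3) (f : Fin 3 → M → ℝ) (p : M) :
    Θ.toFun p (e.frame a p) (e.comb f p) = ∑ b, f b p * e.comp Θ a b p := by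
  simp [comb, comp, map_sum]

theorem comp_comb_left (f : Fin 3 → M → ℝ) (p : M) (v : TangentSpace (𝓡 3) p) :
    Θ.toFun p (e.comb f p) v = ∑ b, f b p * Θ.toFun p (e.frame b p) v := by
  simp [comb, map_sum]

/-- The components of `d Tr(Θ) - div(Θ)` in the frame dual to `e`. -/
def momentumDefect (b : Fin 3) (p : M) : ℝ :=
  ∑ a, dirDeriv (e.frame b) (e.comp Θ a a) p - ∑ a, (dirDeriv (e.frame a) (e.comp Θ a b) p
    - ∑ k, e.conn a a k p * e.comp Θ k b p - ∑ k, e.conn a b k p * e.comp Θ a k p)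

theorem momentum_comb {f : Fin 3 → M → ℝ} (hf : ∀ a, IsSmoothFun (f a)) (p : M) :
    dirDeriv (e.comb f) (e.tr Θ) p - e.div Θ (e.comb f) p =
      ∑ b, f b p * e.momentumDefect Θ b p := by
  have htr : ∀ b, dirDeriv (e.frame b) (e.tr Θ) p =
      ∑ a, dirDeriv (e.frame b) (e.comp Θ a a) p := fun b =>
    dirDeriv_sum _ p fun a _ => e.comp_smooth Θ a a
  have hd : ∀ a, dirDeriv (e.frame a) (fun q => Θ.toFun q (e.frame a q) (e.comb f q)) p =
      ∑ b, (f b p * dirDeriv (e.frame a) (e.comp Θ a b) p +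
        e.comp Θ a b p * dirDeriv (e.frame a) (f b) p) := fun a => by
    simp only [comp_comb_right]
    rw [dirDeriv_sum _ p fun b _ => (hf b).mul (e.comp_smooth Θ a b)]
    exact Finset.sum_congr rfl fun b _ => dirDeriv_mul _ p (hf b) (e.comp_smooth Θ a b)
  simp only [dirDeriv_comb, div, nablaTensor, htr, hd]
  simp only [nabla_frame_frame, e.nabla_frame_comb _ hf, comp_comb_right, comp_comb_left,
    momentumDefect, Fin.sum_univ_three]
  ring

theorem momentumConstraint_iff :
    MomentumConstraint e Θ ↔ ∀ b p, e.momentumDefect Θ b p = 0 := by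
  constructor
  · intro h b p
    have key := e.momentum_comb Θ (f := fun k _ => if k = b then 1 else 0)
      (fun _ => isSmoothFun_const _) p
    rw [← frame_eq_comb, h _ (e.frame_smooth b), sub_self] at key
    simpa using key.symm
  · intro h X hX p
    have key := e.momentum_comb Θ (f := fun a p => e.form a p (X p))
      (fun a => (e.smooth a).apply hX) p
    rw [← eq_comb] at key
    simpa [h, sub_eq_zero] using key

end Coframe

theorem Coframe.extDeriv1_form (e : Coframe M) (a b k : Fin 3) (p : M) :
    extDeriv1 (e.form k) (e.frame a) (e.frame b) p = -e.struct a b k p := by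
  simp [extDeriv1, Coframe.form_frame, dirDeriv_const, Coframe.struct]

namespace IsKillingCauchyPair

variable {lam : ℝ} {e : Coframe M} {Θ : SymTensor M}

theorem struct_eq (h : IsKillingCauchyPair lam e Θ) (a b k : Fin 3) : e.struct a b k = fun p =>
    e.comp Θ k b p * (if a = 0 then 1 else 0) - e.comp Θ k a p * (if b = 0 then 1 else 0)
      + lam * (if k = 1 then 0 else (if k = b then 1 else 0) * (if a = 1 then 1 else 0)
        - (if k = a then 1 else 0) * (if b = 1 then 1 else 0)) := by
  funext p
  rw [← neg_neg (e.struct a b k p), ← e.extDeriv1_form]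
  have ha := e.frame_smooth a
  have hb := e.frame_smooth b
  have hcomp : ∀ i j, e.contract Θ i p (e.frame j p) = e.comp Θ i j p := fun _ _ => rfl
  match k with
  | 0 =>
    rw [h.d_u _ _ ha hb]
    simp only [wedge, Coframe.u, Coframe.l, e.form_frame, hcomp, eq_comm (b := a),
      eq_comm (b := b)]
    simp
    ring
  | 1 =>
    rw [h.d_l _ _ ha hb]
    simp only [wedge, Coframe.u, e.form_frame, hcomp, eq_comm (b := a), eq_comm (b := b)]
    simp
  | 2 =>
    rw [h.d_n _ _ ha hb]
    simp only [wedge, Coframe.u, Coframe.l, Coframe.n, e.form_frame, hcomp, eq_comm (b := a),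
      eq_comm (b := b)]
    simp
    ring

theorem struct_smooth (h : IsKillingCauchyPair lam e Θ)
    (a b k : Fin 3) : IsSmoothFun (e.struct a b k) := by
  rw [h.struct_eq]
  exact (((e.comp_smooth Θ k b).mul (isSmoothFun_const _)).sub
    ((e.comp_smooth Θ k a).mul (isSmoothFun_const _))).add (isSmoothFun_const _)

theorem dirDeriv_struct (h : IsKillingCauchyPair lam e Θ)
    (X : VField M) (a b k : Fin 3) (p : M) :
    dirDeriv X (e.struct a b k) p = dirDeriv X (e.comp Θ k b) p * (if a = 0 then 1 else 0)
      - dirDeriv X (e.comp Θ k a) p * (if b = 0 then 1 else 0) := by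
  have h₁ := (e.comp_smooth Θ k b).mul (isSmoothFun_const (if a = 0 then 1 else 0))
  have h₂ := (e.comp_smooth Θ k a).mul (isSmoothFun_const (if b = 0 then 1 else 0))
  rw [h.struct_eq, dirDeriv_add X p (h₁.sub h₂) (isSmoothFun_const _), dirDeriv_sub X p h₁ h₂,
    dirDeriv_mul X p (e.comp_smooth Θ k b) (isSmoothFun_const _),
    dirDeriv_mul X p (e.comp_smooth Θ k a) (isSmoothFun_const _), dirDeriv_const, dirDeriv_const,
    dirDeriv_const]
  ring

theorem closed (h : IsKillingCauchyPair lam e Θ) (a b : Fin 3) (p : M) :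
    dirDeriv (e.frame a) (e.comp Θ 0 b) p - dirDeriv (e.frame b) (e.comp Θ 0 a) p =
      ∑ k, e.struct a b k p * (e.comp Θ 0 k p + lam * if 1 = k then 1 else 0) := by
  have hval : ∀ c, (fun p => (e.contract Θ 0 p + lam • e.l p) (e.frame c p)) =
      fun p => e.comp Θ 0 c p + lam * if 1 = c then 1 else 0 := fun c => by
    funext q
    simp [Coframe.contract, Coframe.comp, Coframe.l, e.form_frame]
  have hsm : ∀ c, IsSmoothFun (fun p => (e.contract Θ 0 p + lam • e.l p) (e.frame c p)) :=
    fun c => by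
      rw [hval]
      exact (e.comp_smooth Θ 0 c).add (isSmoothFun_const _)
  have key := e.exact_closed h.exact hsm a b p
  rw [hval, hval, dirDeriv_add _ p (e.comp_smooth Θ 0 b) (isSmoothFun_const _),
    dirDeriv_add _ p (e.comp_smooth Θ 0 a) (isSmoothFun_const _), dirDeriv_const,
    dirDeriv_const, add_zero, add_zero] at key
  rw [key]
  exact Finset.sum_congr rfl fun k _ => by rw [← congrFun (hval k) p]

theorem momentumDefect_l (h : IsKillingCauchyPair lam e Θ)
    (p : M) : e.momentumDefect Θ 1 p = 0 := by
  have hJ := e.jacobi_frame h.struct_smooth 2 p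
  have hX := h.closed 0 1 p
  simp only [Coframe.momentumDefect, Coframe.conn, h.dirDeriv_struct,
    Fin.sum_univ_three] at hJ hX ⊢
  simp only [h.struct_eq, e.comp_symm Θ 1 0, e.comp_symm Θ 2 0, e.comp_symm Θ 2 1] at hJ hX ⊢
  simp at hJ hX ⊢
  linarith

theorem momentumDefect_n (h : IsKillingCauchyPair lam e Θ)
    (p : M) : e.momentumDefect Θ 2 p = 0 := by
  have hJ := e.jacobi_frame h.struct_smooth 1 p
  have hX := h.closed 0 2 p
  simp only [Coframe.momentumDefect, Coframe.conn, h.dirDeriv_struct,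
    Fin.sum_univ_three] at hJ hX ⊢
  simp only [h.struct_eq, e.comp_symm Θ 1 0, e.comp_symm Θ 2 0, e.comp_symm Θ 2 1] at hJ hX ⊢
  simp at hJ hX ⊢
  linarith

theorem hamiltonian_defect (h : IsKillingCauchyPair lam e Θ) (p : M) :
    e.scal p - (e.normSq Θ p - (e.tr Θ p) ^ 2 + 2 * (-3 * lam ^ 2)) =
      2 * e.momentumDefect Θ 0 p := by
  have hn : e.normSq Θ p = ∑ a, ∑ b, e.comp Θ a b p ^ 2 := rfl
  have ht : e.tr Θ p = ∑ a, e.comp Θ a a p := rfl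
  rw [e.scal_eq h.struct_smooth, hn, ht]
  simp only [Coframe.momentumDefect, e.dirDeriv_conn h.struct_smooth, Coframe.conn,
    h.dirDeriv_struct, Fin.sum_univ_three]
  simp only [h.struct_eq, e.comp_symm Θ 1 0, e.comp_symm Θ 2 0, e.comp_symm Θ 2 1]
  simp
  ring

end IsKillingCauchyPair

end KillingCauchy

end

theorem mainTheorem9 {M : Type*} [TopologicalSpace M] [T2Space M] [SecondCountableTopology M]
    [ChartedSpace (EuclideanSpace ℝ (Fin 3)) M] [IsManifold (𝓡 3) ∞ M]
    (lam : ℝ) (e : KillingCauchy.Coframe M) (Θ : KillingCauchy.SymTensor M)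
    (hpair : KillingCauchy.IsKillingCauchyPair lam e Θ) :
    KillingCauchy.HamiltonianConstraint (-3 * lam ^ 2) e Θ ↔
      KillingCauchy.MomentumConstraint e Θ := by
  rw [e.momentumConstraint_iff Θ]
  constructor
  · intro hH b p
    match b with
    | 0 =>
      have key := hpair.hamiltonian_defect p
      rw [hH p, sub_self] at key
      linarith
    | 1 => exact hpair.momentumDefect_l p
    | 2 => exact hpair.momentumDefect_n p
  · intro hM p
    have key := hpair.hamiltonian_defect p
    rw [hM 0 p, mul_zero] at key
    linarith
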